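/- Let $G$ be a locally compact Polish group (a topological group whose topology is locally compact, separable and completely metrizable), let $\mathbb K$ be $\mathbb R$ or $\mathbb C$, and let $\mathcal H$ be an infinite-dimensional separable Hilbert space over $\mathbb K$. A linear representation of $G$ on a Banach space $X$ by bounded invertible operators, or an affine representation of $G$ on $X$ by continuous affine bijections, is called continuous if the corresponding action $G\times X\to X$ is jointly continuous. A linear representation $\pi$ is bounded if $\sup_{g\in G}\|\pi(g)\|<\infty$. Then the following are equivalent. 1. $G$ is compact. 2. $G$ has property (OB): whenever $G$ acts continuously by isometries on a metric space, every orbit is bounded. 3. $G$ has property (ACR): every continuous affine action of $G$ on a separable reflexive Banach space over $\mathbb K$ has a fixed point. 4. Every continuous linear representation $\pi\colon G\to \mathrm{GL}(\mathcal H)$ is bounded. 5. Every continuous affine representation $\rho\colon G\to \mathrm{Aff}(\mathcal H)$ has a fixed point. 6. Every continuous affine representation $\rho\colon G\to \mathrm{Aff}(\mathcal H)$ has a bounded orbit. In particular, if $G$ is not compact, then $G$ admits a continuous affine representation on $\mathcal H$ all of whose orbits are unbounded. -/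

import Mathlib

universe u v w u₁ u₂ u₃ v₁ v₂

/-- Property (OB): for every continuous isometric action on a metric space, every orbit is
bounded. -/
def PropertyOB (G : Type u) [Group G] [TopologicalSpace G] : Prop :=
  ∀ (X : Type v) [MetricSpace X] [MulAction G X] [IsIsometricSMul G X] [ContinuousSMul G X]
    (x : X), Bornology.IsBounded (MulAction.orbit G x)

section Representations

variable {𝕜 : Type*} [RCLike 𝕜] {G : Type*} [Group G] [TopologicalSpace G]
  {X : Type*} [NormedAddCommGroup X] [NormedSpace 𝕜 X]

/-- A linear representation by bounded automorphisms is continuous if the corresponding action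
is jointly continuous. -/
def IsContinuousLinearRep (π : G →* (X ≃L[𝕜] X)) : Prop :=
  Continuous fun p : G × X => π p.1 p.2

/-- A linear representation is bounded if the operator norms `‖π g‖` are bounded. -/
def IsBoundedLinearRep (π : G →* (X ≃L[𝕜] X)) : Prop :=
  ∃ C : ℝ, ∀ g : G, ‖(π g : X →L[𝕜] X)‖ ≤ C

/-- A representation by affine bijections is continuous if the corresponding action is jointly
continuous; in particular every `ρ g` is then an affine homeomorphism of `X`. -/
def IsContinuousAffineRep (ρ : G →* (X ≃ᵃ[𝕜] X)) : Prop :=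
  Continuous fun p : G × X => ρ p.1 p.2

/-- The orbit of `x` under an affine representation. -/
def affineOrbit (ρ : G →* (X ≃ᵃ[𝕜] X)) (x : X) : Set X :=
  Set.range fun g : G => ρ g x

end Representations

/-- A normed space is reflexive if the canonical map into its bidual is onto. -/
def IsReflexiveSpace (𝕜 : Type*) [RCLike 𝕜] (X : Type*) [NormedAddCommGroup X]
    [NormedSpace 𝕜 X] : Prop :=
  Function.Surjective (NormedSpace.inclusionInDoubleDual 𝕜 X)

/-- Property (ACR): every continuous affine action on a separable reflexive Banach space (over
the scalar field `𝕜`) has a fixed point. -/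
def PropertyACR (𝕜 : Type w) [RCLike 𝕜] (G : Type u) [Group G] [TopologicalSpace G] : Prop :=
  ∀ (X : Type v) [NormedAddCommGroup X] [NormedSpace 𝕜 X] [CompleteSpace X]
    [TopologicalSpace.SeparableSpace X], IsReflexiveSpace 𝕜 X →
    ∀ ρ : G →* (X ≃ᵃ[𝕜] X), IsContinuousAffineRep ρ → ∃ x : X, ∀ g : G, ρ g x = x

/-!
On a noncompact, locally compact, σ-compact group there is a continuous length function `ℓ` with
`∫ exp (-ℓ) < ∞` for Haar measure. It arises by smoothing a weighted word length whose letters are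
compact sets `C`: covering `K * C` by finitely many left translates of `K` shows that prefixing
the letter `C` to a word enlarges the measure of the set it spells by at most a fixed factor, so
`exp (-ℓ)` is integrable once each letter is expensive enough. As Haar measure is infinite, `ℓ` is
unbounded, and the left invariant pseudometric `ℓ (x⁻¹ * y)` violates (OB).

The representation `π g f x = exp (ℓ x - ℓ (g⁻¹ * x)) * f (g⁻¹ * x)` on `L²(G)` is continuous and
every nonzero vector has an unbounded orbit, whereas the functional `⟪exp (-ℓ), ·⟫` is invariant.
Hence `G` acts affinely, with all orbits unbounded, on a hyperplane where this functional is a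
nonzero constant. An infinite-dimensional separable `H` absorbs `L²(G)` and the kernel of the
functional as direct summands.

Conversely, for compact `G` the barycenter of an orbit is a fixed point, and the uniform boundedness
principle bounds linear representations.
-/

open MeasureTheory Set Filter Topology
open scoped ENNReal NNReal Pointwise

section WordSeminorm

theorem tsum_list_map_prod {ι : Type*} (q : ι → ℝ≥0∞) :
    ∑' l : List ι, (l.map q).prod = (1 - ∑' i, q i)⁻¹ := by
  have tsum_tuples (n : ℕ) : ∑' s : Fin n → ι, ∏ k, q (s k) = (∑' i, q i) ^ n := by
    induction n with
    | zero => simp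
    | succ n ih =>
      rw [← (Fin.consEquiv fun _ => ι).tsum_eq, ENNReal.tsum_prod', pow_succ', ← ih,
        ← ENNReal.tsum_mul_right]
      simp [Fin.prod_univ_succ, Fin.consEquiv, ENNReal.tsum_mul_left]
  calc ∑' l : List ι, (l.map q).prod
      = ∑' s : Σ n, Fin n → ι, ∏ k, q (s.2 k) := by
        rw [← List.equivSigmaTuple.symm.tsum_eq]
        simp [List.map_ofFn, List.prod_ofFn]
    _ = (1 - ∑' i, q i)⁻¹ := by
        simp_rw [ENNReal.tsum_sigma', tsum_tuples, ENNReal.tsum_geometric]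

theorem isCompact_list_prod {M ι : Type*} [Monoid M] [TopologicalSpace M] [ContinuousMul M]
    {C : ι → Set M} (hC : ∀ i, IsCompact (C i)) (l : List ι) : IsCompact (l.map C).prod := by
  induction l with
  | nil => simp
  | cons i l ih => simpa using (hC i).mul ih

variable {G ι : Type*} [Group G]

theorem inv_list_prod_of_forall_inv_eq {C : ι → Set G} (hC : ∀ i, (C i)⁻¹ = C i) (l : List ι) :
    (l.map C).prod⁻¹ = (l.reverse.map C).prod := by
  induction l with
  | nil => simp
  | cons i l ih => simp [mul_inv_rev, ih, hC]

theorem measure_mul_list_prod_le [MeasurableSpace G] (μ : Measure G) [μ.IsMulLeftInvariant]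
    {K : Set G} {C : ι → Set G} {F : ι → Finset G} (hF : ∀ i, K * C i ⊆ (F i : Set G) * K)
    (l : List ι) :
    μ (K * (l.map C).prod) ≤ (l.map fun i => ((F i).card : ℝ≥0∞)).prod * μ K := by
  induction l with
  | nil => simp
  | cons i l ih =>
    simp only [List.map_cons, List.prod_cons]
    have covered : K * (C i * (l.map C).prod) ⊆ ⋃ f ∈ F i, f • (K * (l.map C).prod) := by
      rw [← mul_assoc]
      refine (mul_subset_mul_right (hF i)).trans ?_
      rw [mul_assoc, ← iUnion_mul_left_image]
      exact subset_rfl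
    calc μ (K * (C i * (l.map C).prod))
        ≤ ∑ f ∈ F i, μ (f • (K * (l.map C).prod)) :=
          (measure_mono covered).trans (measure_biUnion_finset_le _ _)
      _ = (F i).card * μ (K * (l.map C).prod) := by simp [measure_smul]
      _ ≤ _ := by rw [mul_assoc]; gcongr

theorem exists_finset_mul_subset_mul [TopologicalSpace G] [IsTopologicalGroup G] {K C : Set G}
    (hK : IsCompact K) (hK_nonempty : (interior K).Nonempty) (hC : IsCompact C) :
    ∃ F : Finset G, K * C ⊆ (F : Set G) * K := by
  classical
  obtain ⟨t, ht⟩ := compact_covered_by_mul_left_translates (hK.mul hC) hK_nonempty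
  refine ⟨t.image (·⁻¹), fun x hx => ?_⟩
  obtain ⟨g, hg, hgx⟩ := mem_iUnion₂.1 (ht hx)
  exact mem_mul.2 ⟨g⁻¹, by simpa using hg, g * x, hgx, by simp⟩

/-- The weighted word length: the least total cost of a word `i₁ ⋯ iₙ` such that `x` lies in
`C i₁ * ⋯ * C iₙ`. The letters are sets, and form a symmetric cover so that every element is
spelled by a word and inversion reverses words. -/
noncomputable def wordSeminorm (C : ι → Set G) (cost : ι → ℝ≥0) (hC_inv : ∀ i, (C i)⁻¹ = C i)
    (hC_cover : ∀ x, ∃ i, x ∈ C i) : GroupSeminorm G :=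
  let length (x : G) : ℝ≥0 := ⨅ l : {l : List ι // x ∈ (l.map C).prod}, (l.1.map cost).sum
  have : ∀ x : G, Nonempty {l : List ι // x ∈ (l.map C).prod} := fun x =>
    (hC_cover x).elim fun i hi => ⟨[i], by simpa using hi⟩
  { toFun := fun x => length x
    map_one' := NNReal.coe_eq_zero.2 <|
      nonpos_iff_eq_zero.1 <| ciInf_le_of_le' ⟨[], by simp⟩ (by simp)
    mul_le' := fun x y => by
      refine mod_cast NNReal.le_iInf_add_iInf fun l m =>
        ciInf_le_of_le' ⟨l.1 ++ m.1, ?_⟩ (by simp)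
      simpa using mul_mem_mul l.2 m.2
    inv' := by
      have length_inv_le (x : G) : length x⁻¹ ≤ length x := le_ciInf fun l =>
        ciInf_le_of_le' ⟨l.1.reverse, by
          rw [← inv_list_prod_of_forall_inv_eq hC_inv, Set.inv_mem_inv]
          exact l.2⟩ (by simp)
      exact fun x => congrArg _ <|
        (length_inv_le x).antisymm (by simpa using length_inv_le x⁻¹) }

section

variable {C : ι → Set G} {cost : ι → ℝ≥0} {hC_inv : ∀ i, (C i)⁻¹ = C i}
  {hC_cover : ∀ x, ∃ i, x ∈ C i}

theorem wordSeminorm_le {x : G} {l : List ι} (hx : x ∈ (l.map C).prod) :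
    wordSeminorm C cost hC_inv hC_cover x ≤ (l.map cost).sum :=
  NNReal.coe_le_coe.2 <|
    ciInf_le' (fun l : {l : List ι // x ∈ (l.map C).prod} => (l.1.map cost).sum) ⟨l, hx⟩

theorem wordSeminorm_lt_iff {x : G} {r : ℝ} :
    wordSeminorm C cost hC_inv hC_cover x < r ↔
      ∃ l : List ι, x ∈ (l.map C).prod ∧ ((l.map cost).sum : ℝ) < r := by
  refine ⟨fun h => ?_, fun ⟨l, hx, hl⟩ => (wordSeminorm_le hx).trans_lt hl⟩
  lift r to ℝ≥0 using (apply_nonneg _ x).trans h.le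
  obtain ⟨i, hi⟩ := hC_cover x
  have : Nonempty {l : List ι // x ∈ (l.map C).prod} := ⟨[i], by simpa using hi⟩
  obtain ⟨l, hl⟩ := exists_lt_of_ciInf_lt (NNReal.coe_lt_coe.1 h)
  exact ⟨l.1, l.2, NNReal.coe_lt_coe.2 hl⟩

variable [Countable ι] [TopologicalSpace G] [IsTopologicalGroup G] [T2Space G]
  [MeasurableSpace G] [BorelSpace G]

theorem measurable_wordSeminorm (hC : ∀ i, IsCompact (C i)) :
    Measurable (wordSeminorm C cost hC_inv hC_cover) := by
  refine measurable_of_Iio fun r => ?_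
  have sublevel : wordSeminorm C cost hC_inv hC_cover ⁻¹' Iio r =
      ⋃ l ∈ {l : List ι | ((l.map cost).sum : ℝ) < r}, (l.map C).prod := by
    ext x
    simp [wordSeminorm_lt_iff, and_comm]
  rw [sublevel]
  exact .biUnion (to_countable _) fun l _ => (isCompact_list_prod hC l).measurableSet

theorem lintegral_exp_neg_wordSeminorm_lt_top (hC : ∀ i, IsCompact (C i)) (μ : Measure G)
    [μ.IsMulLeftInvariant] [IsFiniteMeasureOnCompacts μ] {K : Set G} (hK : IsCompact K)
    (hK_one : 1 ∈ K) {F : ι → Finset G} (hF : ∀ i, K * C i ⊆ (F i : Set G) * K)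
    (hcost : ∑' i, (F i).card * ENNReal.ofReal (Real.exp (-cost i)) < 1) :
    ∫⁻ x, ENNReal.ofReal (Real.exp (-wordSeminorm C cost hC_inv hC_cover x)) ∂μ < ∞ := by
  let q (i : ι) : ℝ≥0∞ := ENNReal.ofReal (Real.exp (-cost i))
  have prod_q (l : List ι) :
      (l.map q).prod = ENNReal.ofReal (Real.exp (-(l.map cost).sum)) := by
    induction l with
    | nil => simp
    | cons i l ih =>
      simp [ih, q, Real.exp_add, ENNReal.ofReal_mul (Real.exp_nonneg _), add_comm]
  -- The infimum over words need not be attained, which costs a factor `exp 1`.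
  have le_tsum (x : G) :
      ENNReal.ofReal (Real.exp (-wordSeminorm C cost hC_inv hC_cover x)) ≤
        ENNReal.ofReal (Real.exp 1) *
          ∑' l : List ι, (l.map C).prod.indicator (fun _ => (l.map q).prod) x := by
    obtain ⟨l, hxl, hl⟩ := wordSeminorm_lt_iff.1
      (lt_add_one (wordSeminorm C cost hC_inv hC_cover x))
    grw [← ENNReal.le_tsum l, indicator_of_mem hxl, prod_q, ← ENNReal.ofReal_mul (by positivity),
      ← Real.exp_add]
    gcongr
    linarith
  have measure_le (l : List ι) :
      μ (l.map C).prod ≤ (l.map fun i => ((F i).card : ℝ≥0∞)).prod * μ K :=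
    (measure_mono (subset_mul_right _ hK_one)).trans (measure_mul_list_prod_le μ hF l)
  calc _ ≤ ENNReal.ofReal (Real.exp 1) *
        ∑' l : List ι, (l.map q).prod * μ (l.map C).prod := by
        grw [lintegral_mono le_tsum, lintegral_const_mul' _ _ ENNReal.ofReal_ne_top,
          lintegral_tsum fun l => (measurable_const.indicator
            (isCompact_list_prod hC l).measurableSet).aemeasurable]
        simp_rw [lintegral_indicator_const (isCompact_list_prod hC _).measurableSet]
        rfl
    _ ≤ ENNReal.ofReal (Real.exp 1) *
        ∑' l : List ι, (l.map q).prod * ((l.map fun i => ((F i).card : ℝ≥0∞)).prod * μ K) := by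
        gcongr with l
        exact measure_le l
    _ = ENNReal.ofReal (Real.exp 1) * ((1 - ∑' i, (F i).card * q i)⁻¹ * μ K) := by
        simp_rw [← tsum_list_map_prod, List.prod_map_mul, ← ENNReal.tsum_mul_right]
        congr with l
        ring
    _ < ∞ := ENNReal.mul_lt_top ENNReal.ofReal_lt_top <| ENNReal.mul_lt_top
        (ENNReal.inv_lt_top.2 (tsub_pos_of_lt hcost)) hK.measure_lt_top

end

theorem exists_cost_tsum_mul_exp_neg_lt_one [Countable ι] (N : ι → ℝ≥0) :
    ∃ cost : ι → ℝ≥0, ∑' i, N i * ENNReal.ofReal (Real.exp (-cost i)) < 1 := by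
  obtain ⟨δ, hδ_pos, hδ⟩ := ENNReal.exists_pos_tsum_mul_lt_of_countable one_ne_zero
    (fun i => (N i : ℝ≥0∞)) fun _ => ENNReal.coe_ne_top
  refine ⟨fun i => (-Real.log (δ i)).toNNReal, lt_of_le_of_lt ?_ hδ⟩
  gcongr with i
  rw [← ENNReal.ofReal_coe_nnreal]
  gcongr
  calc Real.exp (-(-Real.log (δ i)).toNNReal)
      ≤ Real.exp (Real.log (δ i)) := by
        gcongr
        exact neg_le.1 (Real.le_coe_toNNReal _)
    _ = δ i := Real.exp_log (hδ_pos i)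

theorem exists_measurable_groupSeminorm_lintegral_exp_neg_lt_top [TopologicalSpace G]
    [IsTopologicalGroup G] [LocallyCompactSpace G] [SigmaCompactSpace G] [T2Space G]
    [MeasurableSpace G] [BorelSpace G] (μ : Measure G) [μ.IsMulLeftInvariant]
    [IsFiniteMeasureOnCompacts μ] :
    ∃ L : GroupSeminorm G, Measurable L ∧ (∀ K : Set G, IsCompact K → BddAbove (L '' K)) ∧
      ∫⁻ x, ENNReal.ofReal (Real.exp (-L x)) ∂μ < ∞ := by
  obtain ⟨K, hK, hK_nhds⟩ := exists_compact_mem_nhds (1 : G)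
  let E : CompactExhaustion G := default
  let C (n : ℕ) : Set G := E n ∪ (E n)⁻¹
  have hC (n : ℕ) : IsCompact (C n) := (E.isCompact n).union (E.isCompact n).inv
  have hC_inv (n : ℕ) : (C n)⁻¹ = C n := by simp [C, union_comm]
  have hC_cover (x : G) : ∃ n, x ∈ C n := (E.exists_mem x).imp fun _ => Or.inl
  choose F hF using fun n =>
    exists_finset_mul_subset_mul hK ⟨1, mem_interior_iff_mem_nhds.2 hK_nhds⟩ (hC n)
  obtain ⟨cost, hcost⟩ := exists_cost_tsum_mul_exp_neg_lt_one fun n => (F n).card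
  refine ⟨wordSeminorm C cost hC_inv hC_cover, measurable_wordSeminorm hC, fun A hA => ?_,
    lintegral_exp_neg_wordSeminorm_lt_top hC μ hK (mem_of_mem_nhds hK_nhds) hF
      (by simpa using hcost)⟩
  obtain ⟨n, hn⟩ := E.exists_superset_of_isCompact hA
  refine ⟨cost n, forall_mem_image.2 fun x hx => ?_⟩
  have hxn : x ∈ ([n].map C).prod := by simpa [C] using Or.inl (hn hx)
  simpa using wordSeminorm_le hxn

end WordSeminorm

section Smoothing

theorem locallyIntegrable_of_norm_le_on_isCompact {X E : Type*} [TopologicalSpace X]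
    [LocallyCompactSpace X] [T2Space X] [MeasurableSpace X] [OpensMeasurableSpace X]
    [NormedAddCommGroup E] {μ : Measure X} [IsFiniteMeasureOnCompacts μ] {f : X → E}
    (hf : AEStronglyMeasurable f μ)
    (hf_bdd : ∀ K, IsCompact K → ∃ M, ∀ x ∈ K, ‖f x‖ ≤ M) : LocallyIntegrable f μ := by
  refine locallyIntegrable_iff.2 fun K hK => ?_
  obtain ⟨M, hM⟩ := hf_bdd K hK
  exact Measure.integrableOn_of_bounded hK.measure_ne_top hf
    ((ae_restrict_mem hK.measurableSet).mono hM)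

variable {G : Type*} [Group G]

/-- The uniform distance from a function to its left translates, as a function of the translating
element. It turns a function with bounded increments into a length function on the group. -/
noncomputable def incrementSeminorm (f : G → ℝ)
    (hf : ∀ g, BddAbove (range fun x => |f (g * x) - f x|)) : GroupSeminorm G where
  toFun g := ⨆ x, |f (g * x) - f x|
  map_one' := by simp
  mul_le' g h := ciSup_le fun x => by
    calc |f (g * h * x) - f x|
        ≤ |f (g * (h * x)) - f (h * x)| + |f (h * x) - f x| := by
          rw [mul_assoc]; exact abs_sub_le _ _ _
      _ ≤ _ := add_le_add (le_ciSup (hf g) (h * x)) (le_ciSup (hf h) x)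
  inv' g := (Equiv.mulLeft g⁻¹).iSup_congr fun x => by simp [abs_sub_comm]

theorem abs_map_inv_mul_sub_le (L : GroupSeminorm G) (x y : G) : |L (y⁻¹ * x) - L x| ≤ L y := by
  simpa using abs_sub_map_le_div L (y⁻¹ * x) x

variable [TopologicalSpace G] [IsTopologicalGroup G]

theorem continuous_groupSeminorm_of_tendsto_one {p : GroupSeminorm G}
    (hp : Tendsto p (𝓝 1) (𝓝 0)) : Continuous p := by
  refine continuous_iff_continuousAt.2 fun a => tendsto_iff_dist_tendsto_zero.2 ?_
  refine squeeze_zero (fun _ => dist_nonneg) (fun x => abs_sub_map_le_div p x a) (hp.comp ?_)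
  simpa using (continuous_id.div_const a).tendsto a

variable [MeasurableSpace G] {μ : Measure G} {L : GroupSeminorm G} {ψ : G → ℝ}

theorem tendsto_integral_abs_translate_sub_mul [WeaklyLocallyCompactSpace G]
    [OpensMeasurableSpace G] {w : G → ℝ} (hw : LocallyIntegrable w μ) (hψ : Continuous ψ)
    (hψ_supp : HasCompactSupport ψ) :
    Tendsto (fun g => ∫ y, |ψ (g * y) - ψ y| * w y ∂μ) (𝓝 1) (𝓝 0) := by
  obtain ⟨V, hV, hV_nhds⟩ := exists_compact_mem_nhds (1 : G)
  have continuousOn_V : ContinuousOn (fun g => ∫ y, |ψ (g * y) - ψ y| * w y ∂μ) V := by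
    have hk : IsCompact (V⁻¹ * tsupport ψ) := hV.inv.mul hψ_supp
    refine continuousOn_integral_bilinear_of_locally_integrable_of_compact_support
      (ContinuousLinearMap.mul ℝ ℝ).flip hk (Continuous.continuousOn ?_) (fun g y hg hy => ?_)
      (hw.integrableOn_isCompact hk)
    · unfold Function.uncurry; fun_prop
    · have vanish (a : G) (ha : a ∈ V) : ψ (a * y) = 0 :=
        image_eq_zero_of_notMem_tsupport fun hay =>
          hy (mem_mul.2 ⟨a⁻¹, inv_mem_inv.2 ha, a * y, hay, by simp⟩)
      have := vanish 1 (mem_of_mem_nhds hV_nhds)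
      simp_all
  simpa using (continuousOn_V.continuousAt hV_nhds).tendsto

variable [BorelSpace G]

theorem locallyIntegrable_map_inv_mul [IsLocallyFiniteMeasure μ] (hL : Measurable L)
    (hL_int : LocallyIntegrable L μ) (x : G) :
    LocallyIntegrable (fun y => L (y⁻¹ * x)) μ := by
  refine (hL_int.add (locallyIntegrable_const (L x))).mono ?_ (.of_forall fun y => ?_)
  · have : Measurable fun y : G => y⁻¹ * x := (by fun_prop : Continuous _).measurable
    exact (hL.comp this).aestronglyMeasurable
  · have := map_mul_le_add L y⁻¹ x
    rw [map_inv_eq_map] at this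
    simpa [abs_of_nonneg, add_nonneg] using this

variable [T2Space G]

theorem abs_integral_mul_map_inv_mul_sub_le [IsLocallyFiniteMeasure μ] [μ.IsMulLeftInvariant]
    (hL : Measurable L) (hL_int : LocallyIntegrable L μ) (hψ : Continuous ψ)
    (hψ_supp : HasCompactSupport ψ) (g x : G) :
    |(∫ y, ψ y * L (y⁻¹ * (g * x)) ∂μ) - ∫ y, ψ y * L (y⁻¹ * x) ∂μ| ≤
      ∫ y, |ψ (g * y) - ψ y| * L y ∂μ := by
  have hψg : Continuous fun y => ψ (g * y) := by fun_prop
  have hψg_supp : HasCompactSupport fun y => ψ (g * y) :=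
    hψ_supp.comp_homeomorph (Homeomorph.mulLeft g)
  have integrable_mul {f : G → ℝ} (hf : Continuous f) (hf_supp : HasCompactSupport f) {w : G → ℝ}
      (hw : LocallyIntegrable w μ) : Integrable (fun y => f y * w y) μ :=
    hw.integrable_smul_left_of_hasCompactSupport hf hf_supp
  have hLx := locallyIntegrable_map_inv_mul hL hL_int x
  have shift : ∫ y, ψ y * L (y⁻¹ * (g * x)) ∂μ = ∫ y, ψ (g * y) * L (y⁻¹ * x) ∂μ := by
    rw [← integral_mul_left_eq_self _ g]
    simp [mul_assoc]
  -- `ψ (g * ·) - ψ` has integral zero, so `L x` may be subtracted from the other factor.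
  have center : ∫ y, (ψ (g * y) - ψ y) * L x ∂μ = 0 := by
    rw [integral_mul_const, integral_sub (hψg.integrable_of_hasCompactSupport hψg_supp)
      (hψ.integrable_of_hasCompactSupport hψ_supp), integral_mul_left_eq_self ψ g]
    simp
  have expand : (∫ y, ψ y * L (y⁻¹ * (g * x)) ∂μ) - ∫ y, ψ y * L (y⁻¹ * x) ∂μ =
      ∫ y, (ψ (g * y) - ψ y) * (L (y⁻¹ * x) - L x) ∂μ := by
    have hφ := integrable_mul (hψg.sub hψ) (hψg_supp.sub hψ_supp) hLx
    have hφ_const :=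
      integrable_mul (hψg.sub hψ) (hψg_supp.sub hψ_supp) (locallyIntegrable_const (L x))
    simp only [Pi.sub_apply] at hφ hφ_const
    rw [shift, ← integral_sub (integrable_mul hψg hψg_supp hLx) (integrable_mul hψ hψ_supp hLx)]
    simp_rw [mul_sub, ← sub_mul]
    rw [integral_sub hφ hφ_const, center, sub_zero]
  rw [expand, ← Real.norm_eq_abs]
  refine norm_integral_le_of_norm_le ?_ (.of_forall fun y => ?_)
  · exact integrable_mul (hψg.sub hψ).abs (hψg_supp.sub hψ_supp).abs hL_int
  · rw [norm_mul]
    exact mul_le_mul_of_nonneg_left (abs_map_inv_mul_sub_le L x y) (norm_nonneg _)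

theorem abs_integral_mul_map_inv_mul_sub_self_le [IsLocallyFiniteMeasure μ]
    (hL : Measurable L) (hL_int : LocallyIntegrable L μ) (hψ : Continuous ψ)
    (hψ_supp : HasCompactSupport ψ) (hψ_nonneg : 0 ≤ ψ) (hψ_one : ∫ y, ψ y ∂μ = 1) (x : G) :
    |(∫ y, ψ y * L (y⁻¹ * x) ∂μ) - L x| ≤ ∫ y, ψ y * L y ∂μ := by
  have hLx := locallyIntegrable_map_inv_mul hL hL_int x
  have integrable_mul {w : G → ℝ} (hw : LocallyIntegrable w μ) :
      Integrable (fun y => ψ y * w y) μ :=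
    hw.integrable_smul_left_of_hasCompactSupport hψ hψ_supp
  have average : (∫ y, ψ y * L (y⁻¹ * x) ∂μ) - L x = ∫ y, ψ y * (L (y⁻¹ * x) - L x) ∂μ := by
    simp_rw [mul_sub]
    rw [integral_sub (integrable_mul hLx) (integrable_mul (locallyIntegrable_const _)),
      integral_mul_const, hψ_one, one_mul]
  rw [average, ← Real.norm_eq_abs]
  refine norm_integral_le_of_norm_le (integrable_mul hL_int) (.of_forall fun y => ?_)
  rw [norm_mul, Real.norm_of_nonneg (hψ_nonneg y)]
  exact mul_le_mul_of_nonneg_left (abs_map_inv_mul_sub_le L x y) (hψ_nonneg y)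

theorem exists_continuous_nonneg_integral_eq_one {X : Type*} [TopologicalSpace X] [RegularSpace X]
    [LocallyCompactSpace X] [Nonempty X] [MeasurableSpace X] [OpensMeasurableSpace X]
    (μ : Measure X) [IsFiniteMeasureOnCompacts μ] [μ.IsOpenPosMeasure] :
    ∃ ψ : X → ℝ, Continuous ψ ∧ HasCompactSupport ψ ∧ 0 ≤ ψ ∧ ∫ x, ψ x ∂μ = 1 := by
  obtain ⟨f, hf_supp, hf_nonneg, hf_one⟩ := exists_continuous_nonneg_pos (Classical.arbitrary X)
  have integral_pos : 0 < ∫ x, f x ∂μ :=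
    f.continuous.integral_pos_of_hasCompactSupport_nonneg_nonzero hf_supp hf_nonneg hf_one
  refine ⟨fun x => (∫ x, f x ∂μ)⁻¹ * f x, by fun_prop, hf_supp.mul_left,
    fun x => mul_nonneg (inv_nonneg.2 integral_pos.le) (hf_nonneg x), ?_⟩
  rw [integral_const_mul, inv_mul_cancel₀ integral_pos.ne']

theorem exists_continuous_groupSeminorm_ge [LocallyCompactSpace G] (hL : Measurable L)
    (hL_bdd : ∀ K, IsCompact K → BddAbove (L '' K)) :
    ∃ ℓ : GroupSeminorm G, Continuous ℓ ∧ ∃ b, ∀ x, L x ≤ ℓ x + b := by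
  have hL_int : LocallyIntegrable L (.haar : Measure G) :=
    locallyIntegrable_of_norm_le_on_isCompact hL.aestronglyMeasurable fun K hK => by
      obtain ⟨M, hM⟩ := hL_bdd K hK
      exact ⟨M, fun x hx => by
        simpa [abs_of_nonneg] using hM (mem_image_of_mem L hx)⟩
  obtain ⟨ψ, hψ, hψ_supp, hψ_nonneg, hψ_one⟩ :=
    exists_continuous_nonneg_integral_eq_one (Measure.haar : Measure G)
  let A (x : G) : ℝ := ∫ y, ψ y * L (y⁻¹ * x) ∂.haar
  have increment_le := abs_integral_mul_map_inv_mul_sub_le hL hL_int hψ hψ_supp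
  have average_sub_le :=
    abs_integral_mul_map_inv_mul_sub_self_le hL hL_int hψ hψ_supp hψ_nonneg hψ_one
  have hA (g : G) : BddAbove (range fun x => |A (g * x) - A x|) :=
    ⟨_, forall_mem_range.2 (increment_le g)⟩
  let ℓ := incrementSeminorm A hA
  refine ⟨ℓ, continuous_groupSeminorm_of_tendsto_one <| squeeze_zero (apply_nonneg ℓ)
    (fun g => ciSup_le (increment_le g))
    (tendsto_integral_abs_translate_sub_mul hL_int hψ hψ_supp),
    2 * ∫ y, ψ y * L y ∂.haar, fun x => ?_⟩
  have increment_one : |A (x * 1) - A 1| ≤ ℓ x := le_ciSup (hA x) 1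
  have average_x : |A x - L x| ≤ _ := average_sub_le x
  have average_one : |A 1 - L 1| ≤ _ := average_sub_le 1
  rw [mul_one] at increment_one
  rw [map_one_eq_zero] at average_one
  linarith [abs_le.1 increment_one, abs_le.1 average_x, abs_le.1 average_one]

end Smoothing

theorem exists_continuous_groupSeminorm_integrable_exp_neg {G : Type*} [Group G]
    [TopologicalSpace G] [IsTopologicalGroup G] [LocallyCompactSpace G] [SigmaCompactSpace G]
    [T2Space G] [MeasurableSpace G] [BorelSpace G] (μ : Measure G) [μ.IsMulLeftInvariant]
    [IsFiniteMeasureOnCompacts μ] :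
    ∃ ℓ : GroupSeminorm G, Continuous ℓ ∧ Integrable (fun x => Real.exp (-ℓ x)) μ := by
  obtain ⟨L, hL, hL_bdd, hL_exp⟩ :=
    exists_measurable_groupSeminorm_lintegral_exp_neg_lt_top μ
  obtain ⟨ℓ, hℓ, b, hb⟩ := exists_continuous_groupSeminorm_ge hL hL_bdd
  have integrable_L : Integrable (fun x => Real.exp (-L x)) μ :=
    ⟨(by fun_prop : Measurable _).aestronglyMeasurable, by
      rwa [hasFiniteIntegral_iff_ofReal (.of_forall fun _ => Real.exp_nonneg _)]⟩
  refine ⟨ℓ, hℓ, (integrable_L.const_mul (Real.exp b)).mono'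
    (by fun_prop : Measurable _).aestronglyMeasurable (.of_forall fun x => ?_)⟩
  rw [Real.norm_of_nonneg (Real.exp_nonneg _), ← Real.exp_add]
  gcongr
  linarith [hb x]

theorem not_bddAbove_range_of_integrable_exp_neg {G : Type*} [Group G]
    [TopologicalSpace G] [IsTopologicalGroup G] [LocallyCompactSpace G] [NoncompactSpace G]
    [MeasurableSpace G] [BorelSpace G] {μ : Measure G} [μ.IsMulLeftInvariant]
    [μ.IsOpenPosMeasure] {ℓ : G → ℝ} (hℓ : Integrable (fun x => Real.exp (-ℓ x)) μ) :
    ¬ BddAbove (range ℓ) := by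
  rintro ⟨M, hM⟩
  have integrable_const_exp : Integrable (fun _ : G => Real.exp (-M)) μ :=
    hℓ.mono' aestronglyMeasurable_const <| .of_forall fun x => by
      rw [Real.norm_of_nonneg (Real.exp_nonneg _)]
      gcongr
      exact hM (mem_range_self x)
  rw [integrable_const_iff_isFiniteMeasure (Real.exp_ne_zero _)] at integrable_const_exp
  exact (measure_ne_top μ univ) (measure_univ_of_isMulLeftInvariant μ)

section OB

theorem small_of_separableSpace (X : Type*) [MetricSpace X]
    [TopologicalSpace.SeparableSpace X] : Small.{v} X := by
  rcases isEmpty_or_nonempty X with h | h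
  · infer_instance
  refine small_of_injective (β := ℕ → ℝ)
    (f := fun x n => dist x (TopologicalSpace.denseSeq X n)) fun x y hxy => ?_
  have dist_eq : (fun z => dist x z) = fun z => dist y z :=
    (TopologicalSpace.denseRange_denseSeq X).equalizer (by fun_prop) (by fun_prop) hxy
  simpa using (congrFun dist_eq y)

instance {G X : Type*} [SMul G X] [PseudoMetricSpace X] [IsIsometricSMul G X] :
    IsIsometricSMul G (SeparationQuotient X) :=
  ⟨fun g => Isometry.of_dist_eq <| SeparationQuotient.surjective_mk.forall₂.2 fun x y => by
    simp [← SeparationQuotient.mk_smul, SeparationQuotient.dist_mk]⟩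

theorem continuousSMul_of_isIsometricSMul {G X : Type*} [SMul G X] [TopologicalSpace G]
    [PseudoMetricSpace X] [IsIsometricSMul G X] (h : ∀ x : X, Continuous fun g : G => g • x) :
    ContinuousSMul G X := by
  refine ⟨continuous_iff_continuousAt.2 fun ⟨g₀, x₀⟩ => tendsto_iff_dist_tendsto_zero.2 ?_⟩
  have bound : Continuous fun p : G × X => dist p.2 x₀ + dist (p.1 • x₀) (g₀ • x₀) := by
    have := h x₀
    fun_prop
  refine squeeze_zero (fun _ => dist_nonneg) (fun p => ?_) (by simpa using bound.tendsto (g₀, x₀))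
  calc dist (p.1 • p.2) (g₀ • x₀)
      ≤ dist (p.1 • p.2) (p.1 • x₀) + dist (p.1 • x₀) (g₀ • x₀) := dist_triangle _ _ _
    _ = _ := by rw [dist_smul]

theorem PropertyOB.isBounded_orbit_of_small {G : Type u} [Group G] [TopologicalSpace G]
    (h : PropertyOB.{u, v} G) {X : Type*} [Small.{v} X] [MetricSpace X] [MulAction G X]
    [IsIsometricSMul G X] [ContinuousSMul G X] (x : X) :
    Bornology.IsBounded (MulAction.orbit G x) := by
  obtain ⟨S, ⟨e⟩⟩ := Small.equiv_small.{v} (α := X)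
  let _ : MetricSpace S := MetricSpace.induced e.symm e.symm.injective inferInstance
  let _ : MulAction G S := e.symm.mulAction G
  have isometry_e : Isometry e.symm := fun _ _ => rfl
  have e_smul (g : G) (s : S) : e.symm (g • s) = g • e.symm s := by simp [Equiv.smul_def]
  have : IsIsometricSMul G S := ⟨fun g s t => by
    rw [← isometry_e.edist_eq, e_smul, e_smul, edist_smul_left, isometry_e.edist_eq]⟩
  have : ContinuousSMul G S := ⟨by
    rw [isometry_e.isEmbedding.continuous_iff]
    simp only [Function.comp_def, e_smul]
    exact continuous_fst.smul (isometry_e.continuous.comp continuous_snd)⟩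
  refine (isometry_e.lipschitz.isBounded_image (h S (e x))).subset ?_
  rintro _ ⟨g, rfl⟩
  exact ⟨g • e x, ⟨g, rfl⟩, by simp [e_smul]⟩

theorem PropertyOB.isBounded_orbit {G : Type u} [Group G] [TopologicalSpace G]
    (h : PropertyOB.{u, v} G) {X : Type*} [PseudoMetricSpace X] [TopologicalSpace.SeparableSpace X]
    [MulAction G X] [IsIsometricSMul G X] [ContinuousSMul G X] (x : X) :
    Bornology.IsBounded (MulAction.orbit G x) := by
  have : TopologicalSpace.SeparableSpace (SeparationQuotient X) :=
    SeparationQuotient.surjective_mk.denseRange.separableSpace SeparationQuotient.continuous_mk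
  have : Small.{v} (SeparationQuotient X) := small_of_separableSpace _
  obtain ⟨C, hC⟩ :=
    Metric.isBounded_iff.1 (h.isBounded_orbit_of_small (SeparationQuotient.mk x))
  exact Metric.isBounded_iff.2 ⟨C, by
    rintro _ ⟨g, rfl⟩ _ ⟨k, rfl⟩
    exact hC ⟨g, rfl⟩ ⟨k, rfl⟩⟩

/-- The group `G` with the left invariant pseudometric `dist x y = ℓ (x⁻¹ * y)` instead of its own
topology. -/
def WithLength {G : Type*} [Group G] (_ℓ : GroupSeminorm G) : Type _ := G

namespace WithLength

variable {G : Type*} [Group G] (ℓ : GroupSeminorm G)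

noncomputable instance : SeminormedGroup (WithLength ℓ) :=
  GroupSeminorm.toSeminormedGroup (E := G) ℓ

instance : MulAction G (WithLength ℓ) := inferInstanceAs (MulAction G G)

/-- The identity map from `G`, which changes the topology. -/
def of : G ≃ WithLength ℓ := Equiv.refl G

theorem smul_of (g x : G) : g • of ℓ x = of ℓ (g * x) := rfl

theorem dist_of (x y : G) : dist (of ℓ x) (of ℓ y) = ℓ (x⁻¹ * y) := rfl

instance : IsIsometricSMul G (WithLength ℓ) :=
  ⟨fun g => Isometry.of_dist_eq <| (of ℓ).surjective.forall₂.2 fun x y => by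
    simp [smul_of, dist_of, mul_assoc]⟩

variable [TopologicalSpace G] [IsTopologicalGroup G] {ℓ}

theorem continuous_of (hℓ : Continuous ℓ) : Continuous (of ℓ) := by
  refine continuous_iff_continuousAt.2 fun x => tendsto_iff_dist_tendsto_zero.2 ?_
  have : Continuous fun y => ℓ (y⁻¹ * x) := by fun_prop
  simpa [dist_of] using this.tendsto x

theorem continuousSMul (hℓ : Continuous ℓ) : ContinuousSMul G (WithLength ℓ) :=
  continuousSMul_of_isIsometricSMul <| (of ℓ).surjective.forall.2 fun x =>
    (continuous_of hℓ).comp (continuous_mul_const x)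

end WithLength

theorem PropertyOB.bddAbove_range {G : Type u} [Group G] [TopologicalSpace G]
    [IsTopologicalGroup G] [TopologicalSpace.SeparableSpace G] (h : PropertyOB.{u, v} G)
    {ℓ : GroupSeminorm G} (hℓ : Continuous ℓ) : BddAbove (range ℓ) := by
  have : TopologicalSpace.SeparableSpace (WithLength ℓ) :=
    (WithLength.of ℓ).surjective.denseRange.separableSpace (WithLength.continuous_of hℓ)
  have := WithLength.continuousSMul hℓ
  obtain ⟨C, hC⟩ := Metric.isBounded_iff.1 (h.isBounded_orbit (WithLength.of ℓ 1))
  refine ⟨C, forall_mem_range.2 fun g => ?_⟩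
  have dist_le := hC ⟨1, rfl⟩ ⟨g, rfl⟩
  simpa [WithLength.smul_of, WithLength.dist_of] using dist_le

theorem PropertyOB.compactSpace {G : Type u} [Group G] [TopologicalSpace G]
    [IsTopologicalGroup G] [LocallyCompactSpace G] [SigmaCompactSpace G] [T2Space G]
    [TopologicalSpace.SeparableSpace G] (h : PropertyOB.{u, v} G) : CompactSpace G := by
  borelize G
  by_contra hG
  have : NoncompactSpace G := not_compactSpace_iff.1 hG
  obtain ⟨ℓ, hℓ, hℓ_int⟩ :=
    exists_continuous_groupSeminorm_integrable_exp_neg (Measure.haar : Measure G)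
  exact not_bddAbove_range_of_integrable_exp_neg hℓ_int (h.bddAbove_range hℓ)

theorem PropertyOB.of_compactSpace (G : Type u) [Group G] [TopologicalSpace G] [CompactSpace G] :
    PropertyOB.{u, v} G := fun X _ _ _ _ x =>
  (isCompact_range (f := fun g : G => g • x) (by fun_prop)).isBounded

end OB

section WeightedTranslation

section LengthCocycle

variable {G : Type*} [Group G]

theorem abs_map_inv_mul_sub_map_inv_mul_le (ℓ : GroupSeminorm G) (g h x : G) :
    |ℓ (h⁻¹ * x) - ℓ (g⁻¹ * x)| ≤ ℓ (g⁻¹ * h) := by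
  simpa [div_eq_mul_inv, abs_sub_comm] using abs_sub_map_le_div ℓ (g⁻¹ * x) (h⁻¹ * x)

/-- The multiplicative cocycle over left translation given by the coboundary of `exp ∘ ℓ`. It is
the density by which translations are twisted to make their orbits grow like `exp ∘ ℓ`. -/
noncomputable def lengthCocycle (ℓ : GroupSeminorm G) (g x : G) : ℝ :=
  Real.exp (ℓ x - ℓ (g⁻¹ * x))

theorem lengthCocycle_pos (ℓ : GroupSeminorm G) (g x : G) : 0 < lengthCocycle ℓ g x :=
  Real.exp_pos _

theorem lengthCocycle_one (ℓ : GroupSeminorm G) (x : G) : lengthCocycle ℓ 1 x = 1 := by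
  simp [lengthCocycle]

theorem lengthCocycle_mul (ℓ : GroupSeminorm G) (g h x : G) :
    lengthCocycle ℓ (g * h) x = lengthCocycle ℓ g x * lengthCocycle ℓ h (g⁻¹ * x) := by
  simp [lengthCocycle, ← Real.exp_add, mul_assoc]

theorem lengthCocycle_le (ℓ : GroupSeminorm G) (g x : G) :
    lengthCocycle ℓ g x ≤ Real.exp (ℓ g) := by
  rw [lengthCocycle, Real.exp_le_exp]
  linarith [abs_le.1 (abs_map_inv_mul_sub_le ℓ x g)]

theorem exp_mul_exp_le_lengthCocycle (ℓ : GroupSeminorm G) (g x : G) :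
    Real.exp (ℓ g) * Real.exp (-2 * ℓ (g⁻¹ * x)) ≤ lengthCocycle ℓ g x := by
  have := map_div_le_add ℓ x (g⁻¹ * x)
  simp only [div_eq_mul_inv, mul_inv_rev, inv_inv, mul_inv_cancel_left] at this
  rw [lengthCocycle, ← Real.exp_add, Real.exp_le_exp]
  linarith

theorem abs_exp_sub_one_le_exp_abs_sub_one (t : ℝ) : |Real.exp t - 1| ≤ Real.exp |t| - 1 := by
  refine abs_le.2 ⟨?_, by gcongr; exact le_abs_self t⟩
  have : Real.exp (-|t|) ≤ Real.exp t := Real.exp_le_exp.2 (neg_abs_le t)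
  linarith [Real.add_one_le_exp |t|, Real.add_one_le_exp (-|t|)]

theorem abs_lengthCocycle_sub_le (ℓ : GroupSeminorm G) (g h x : G) :
    |lengthCocycle ℓ g x - lengthCocycle ℓ h x| ≤
      Real.exp (ℓ h) * (Real.exp (ℓ (g⁻¹ * h)) - 1) := by
  have factor : lengthCocycle ℓ g x - lengthCocycle ℓ h x =
      lengthCocycle ℓ h x * (Real.exp (ℓ (h⁻¹ * x) - ℓ (g⁻¹ * x)) - 1) := by
    simp only [lengthCocycle, mul_sub, ← Real.exp_add]
    ring_nf
  rw [factor, abs_mul, abs_of_pos (lengthCocycle_pos ℓ h x)]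
  gcongr
  · exact lengthCocycle_le ℓ h x
  · refine (abs_exp_sub_one_le_exp_abs_sub_one _).trans ?_
    gcongr
    exact abs_map_inv_mul_sub_map_inv_mul_le ℓ g h x

theorem continuous_lengthCocycle [TopologicalSpace G] [ContinuousMul G] {ℓ : GroupSeminorm G}
    (hℓ : Continuous ℓ) (g : G) : Continuous (lengthCocycle ℓ g) := by
  unfold lengthCocycle
  fun_prop

end LengthCocycle

section BoundedMul

variable {𝕜 : Type*} [RCLike 𝕜] {E : Type*} [NormedAddCommGroup E] [NormedSpace 𝕜 E]
  {p : ℝ≥0∞} [Fact (1 ≤ p)] {α : Type*} [MeasurableSpace α] {μ : Measure α}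

/-- Multiplication of `L^p` functions by bounded functions. -/
noncomputable def boundedMul : Lp 𝕜 ∞ μ →L[𝕜] Lp E p μ →L[𝕜] Lp E p μ :=
  (ContinuousLinearMap.lsmul 𝕜 𝕜).holderL μ ∞ p p

theorem coeFn_boundedMul (a : Lp 𝕜 ∞ μ) (f : Lp E p μ) :
    boundedMul a f =ᵐ[μ] fun x => a x • f x :=
  (ContinuousLinearMap.lsmul 𝕜 𝕜).coeFn_holder (r := p) a f

theorem boundedMul_ne_zero {a : Lp 𝕜 ∞ μ} (ha : ∀ᵐ x ∂μ, a x ≠ 0) {f : Lp E p μ} (hf : f ≠ 0) :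
    boundedMul a f ≠ 0 := by
  refine mt (fun h => ?_) hf
  rw [Lp.eq_zero_iff_ae_eq_zero] at h ⊢
  filter_upwards [h, coeFn_boundedMul a f, ha] with x hx hmul hax
  exact (smul_eq_zero.1 (hmul.symm.trans hx)).resolve_left hax

theorem dist_toLp_top_le {f g : α → E} (hf : MemLp f ∞ μ) (hg : MemLp g ∞ μ) {C : ℝ} (hC : 0 ≤ C)
    (h : ∀ x, ‖f x - g x‖ ≤ C) : dist (hf.toLp f) (hg.toLp g) ≤ C := by
  rw [← ENNReal.ofReal_le_ofReal_iff hC, ← edist_dist, Lp.edist_toLp_toLp, eLpNorm_exponent_top]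
  exact eLpNormEssSup_le_of_ae_bound (.of_forall h)

theorem memLp_top_ofReal {a : α → ℝ} (ha : Measurable a) {C : ℝ} (hC : ∀ x, |a x| ≤ C) :
    MemLp (fun x => (a x : 𝕜)) ∞ μ :=
  memLp_top_of_bound (RCLike.measurable_ofReal.comp ha).aestronglyMeasurable C
    (.of_forall fun x => by simpa using hC x)

theorem memLp_two_ofReal_of_integrable {a : α → ℝ} (ha : Integrable a μ) (h0 : ∀ x, 0 ≤ a x)
    (h1 : ∀ x, a x ≤ 1) : MemLp (fun x => (a x : 𝕜)) 2 μ := by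
  have hmeas : AEStronglyMeasurable (fun x => (a x : 𝕜)) μ :=
    RCLike.continuous_ofReal.comp_aestronglyMeasurable ha.1
  rw [memLp_two_iff_integrable_sq_norm hmeas]
  refine ha.mono' (hmeas.norm.pow 2) (.of_forall fun x => ?_)
  rw [RCLike.norm_ofReal, sq_abs, Real.norm_of_nonneg (sq_nonneg _)]
  nlinarith [h0 x, h1 x]

end BoundedMul

variable {𝕜 : Type*} [RCLike 𝕜] {E : Type*} [NormedAddCommGroup E] [NormedSpace 𝕜 E]
  {p : ℝ≥0∞} [Fact (1 ≤ p)] {G : Type*} [Group G] [MeasurableSpace G] {μ : Measure G}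
  {ℓ : GroupSeminorm G}

variable (𝕜 μ) in
/-- The function `exp (-2 ℓ)` as an element of `L^∞`. -/
noncomputable def expNegTwoMulLp (hℓ : Measurable ℓ) : Lp 𝕜 ∞ μ :=
  (memLp_top_ofReal (a := fun x => Real.exp (-2 * ℓ x)) (C := 1) (by fun_prop)
    fun x => by simp).toLp _

theorem coeFn_expNegTwoMulLp (hℓ : Measurable ℓ) :
    expNegTwoMulLp 𝕜 μ hℓ =ᵐ[μ] fun x => (Real.exp (-2 * ℓ x) : 𝕜) :=
  MemLp.coeFn_toLp _

variable [TopologicalSpace G] [IsTopologicalGroup G] [BorelSpace G]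

variable (𝕜 μ) in
/-- The function `lengthCocycle ℓ g` as an element of `L^∞`. -/
noncomputable def lengthCocycleLp (hℓ : Continuous ℓ) (g : G) : Lp 𝕜 ∞ μ :=
  (memLp_top_ofReal (continuous_lengthCocycle hℓ g).measurable fun x =>
    (abs_of_pos (lengthCocycle_pos ℓ g x)).trans_le (lengthCocycle_le ℓ g x)).toLp _

theorem coeFn_lengthCocycleLp (hℓ : Continuous ℓ) (g : G) :
    lengthCocycleLp 𝕜 μ hℓ g =ᵐ[μ] fun x => (lengthCocycle ℓ g x : 𝕜) :=
  MemLp.coeFn_toLp _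

theorem continuous_lengthCocycleLp (hℓ : Continuous ℓ) :
    Continuous (lengthCocycleLp 𝕜 μ hℓ) := by
  refine continuous_iff_continuousAt.2 fun h => tendsto_iff_dist_tendsto_zero.2 ?_
  have bound : Tendsto (fun g => Real.exp (ℓ h) * (Real.exp (ℓ (g⁻¹ * h)) - 1)) (𝓝 h) (𝓝 0) := by
    have : Continuous fun g => Real.exp (ℓ h) * (Real.exp (ℓ (g⁻¹ * h)) - 1) := by fun_prop
    simpa using this.tendsto h
  refine squeeze_zero (fun _ => dist_nonneg) (fun g => ?_) bound
  refine dist_toLp_top_le _ _ ?_ fun x => ?_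
  · exact (abs_nonneg _).trans (abs_lengthCocycle_sub_le ℓ g h 1)
  · rw [← RCLike.ofReal_sub, RCLike.norm_ofReal]
    exact abs_lengthCocycle_sub_le ℓ g h x

variable [μ.IsMulLeftInvariant]

variable (𝕜) in
/-- The operator `f ↦ (x ↦ exp (ℓ x - ℓ (g⁻¹ x)) f (g⁻¹ x))` on `L^p`. -/
noncomputable def weightedTranslation (hℓ : Continuous ℓ) (g : G) : Lp E p μ →L[𝕜] Lp E p μ :=
  boundedMul (lengthCocycleLp 𝕜 μ hℓ g) ∘L
    (Lp.compMeasurePreservingₗᵢ 𝕜 (g⁻¹ * ·)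
      (measurePreserving_mul_left μ g⁻¹)).toContinuousLinearMap

theorem coeFn_weightedTranslation (hℓ : Continuous ℓ) (g : G) (f : Lp E p μ) :
    weightedTranslation 𝕜 hℓ g f =ᵐ[μ] fun x => (lengthCocycle ℓ g x : 𝕜) • f (g⁻¹ * x) := by
  have translate := Lp.coeFn_compMeasurePreserving f (measurePreserving_mul_left μ g⁻¹)
  filter_upwards [coeFn_boundedMul (lengthCocycleLp 𝕜 μ hℓ g) (Lp.compMeasurePreservingₗᵢ 𝕜 _
    (measurePreserving_mul_left μ g⁻¹) f), coeFn_lengthCocycleLp (𝕜 := 𝕜) hℓ g, translate]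
    with x hmul hcocycle htranslate
  rw [← hcocycle]
  exact hmul.trans (congrArg _ htranslate)

theorem continuous_weightedTranslation [R1Space G] [IsLocallyFiniteMeasure μ]
    [μ.InnerRegularCompactLTTop] [Fact (p ≠ ∞)] (hℓ : Continuous ℓ) :
    Continuous fun z : G × Lp E p μ => weightedTranslation 𝕜 hℓ z.1 z.2 := by
  have translate : Continuous fun z : G × Lp E p μ => DomMulAct.mk z.1⁻¹ • z.2 := by fun_prop
  have mul : Continuous fun z : G × Lp E p μ =>
      boundedMul (E := E) (p := p) (lengthCocycleLp 𝕜 μ hℓ z.1) :=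
    boundedMul.continuous.comp ((continuous_lengthCocycleLp hℓ).comp continuous_fst)
  exact mul.clm_apply translate

variable (𝕜 E p μ) in
/-- The representation of `G` on `L^p` by translations weighted with `lengthCocycle ℓ`. -/
noncomputable def weightedTranslationRep (hℓ : Continuous ℓ) :
    G →* (Lp E p μ ≃L[𝕜] Lp E p μ) :=
  (ContinuousLinearEquiv.unitsEquiv 𝕜 (Lp E p μ)).toMonoidHom.comp <| MonoidHom.toHomUnits
    { toFun := weightedTranslation 𝕜 hℓ
      map_one' := by
        ext f
        filter_upwards [coeFn_weightedTranslation (𝕜 := 𝕜) hℓ 1 f] with x hx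
        simp [hx, lengthCocycle_one]
      map_mul' g h := by
        ext f
        filter_upwards [coeFn_weightedTranslation (𝕜 := 𝕜) hℓ (g * h) f,
          coeFn_weightedTranslation (𝕜 := 𝕜) hℓ g (weightedTranslation 𝕜 hℓ h f),
          (measurePreserving_mul_left μ g⁻¹).quasiMeasurePreserving.ae
            (coeFn_weightedTranslation (𝕜 := 𝕜) hℓ h f)] with x hgh hg hh
        simp only [mul_apply_eq_comp, hgh, hg, hh, lengthCocycle_mul, smul_smul,
          RCLike.ofReal_mul, mul_inv_rev, mul_assoc] }

theorem coeFn_weightedTranslationRep (hℓ : Continuous ℓ) (g : G) (f : Lp E p μ) :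
    weightedTranslationRep 𝕜 E p μ hℓ g f =ᵐ[μ]
      fun x => (lengthCocycle ℓ g x : 𝕜) • f (g⁻¹ * x) :=
  coeFn_weightedTranslation hℓ g f

theorem isContinuousLinearRep_weightedTranslationRep [R1Space G] [IsLocallyFiniteMeasure μ]
    [μ.InnerRegularCompactLTTop] [Fact (p ≠ ∞)] (hℓ : Continuous ℓ) :
    IsContinuousLinearRep (weightedTranslationRep 𝕜 E p μ hℓ) :=
  continuous_weightedTranslation hℓ

theorem exp_mul_norm_le_norm_weightedTranslationRep (hℓ : Continuous ℓ) (g : G) (f : Lp E p μ) :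
    Real.exp (ℓ g) * ‖boundedMul (expNegTwoMulLp 𝕜 μ hℓ.measurable) f‖ ≤
      ‖weightedTranslationRep 𝕜 E p μ hℓ g f‖ := by
  have hg := measurePreserving_mul_left μ g⁻¹
  set F := boundedMul (expNegTwoMulLp 𝕜 μ hℓ.measurable) f with hF
  have norm_translate : Real.exp (ℓ g) * ‖F‖ =
      ‖(Real.exp (ℓ g) : 𝕜) • Lp.compMeasurePreserving _ hg F‖ := by
    rw [norm_smul, Lp.norm_compMeasurePreserving, RCLike.norm_ofReal, Real.abs_exp]
  rw [norm_translate]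
  refine Lp.norm_le_norm_of_ae_le ?_
  filter_upwards [Lp.coeFn_smul (Real.exp (ℓ g) : 𝕜) (Lp.compMeasurePreserving _ hg F),
    Lp.coeFn_compMeasurePreserving F hg, coeFn_weightedTranslationRep (𝕜 := 𝕜) hℓ g f,
    hg.quasiMeasurePreserving.ae (coeFn_boundedMul (expNegTwoMulLp 𝕜 μ hℓ.measurable) f),
    hg.quasiMeasurePreserving.ae (coeFn_expNegTwoMulLp (𝕜 := 𝕜) hℓ.measurable)]
    with x hsmul hcomp hrep hmul hexp
  rw [hsmul, Pi.smul_apply, hcomp, hrep, Function.comp_apply, hF, hmul, hexp, smul_smul,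
    norm_smul, norm_smul, ← RCLike.ofReal_mul, RCLike.norm_ofReal, RCLike.norm_ofReal,
    abs_of_pos (lengthCocycle_pos ℓ g x), abs_of_pos (by positivity)]
  gcongr
  exact exp_mul_exp_le_lengthCocycle ℓ g x

theorem exists_lt_norm_weightedTranslationRep (hℓ : Continuous ℓ) (hub : ¬ BddAbove (range ℓ))
    {f : Lp E p μ} (hf : f ≠ 0) (C : ℝ) :
    ∃ g, C < ‖weightedTranslationRep 𝕜 E p μ hℓ g f‖ := by
  have weight_ne_zero : ∀ᵐ x ∂μ, expNegTwoMulLp 𝕜 μ hℓ.measurable x ≠ 0 := by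
    filter_upwards [coeFn_expNegTwoMulLp (𝕜 := 𝕜) hℓ.measurable] with x hx
    rw [hx]
    exact RCLike.ofReal_ne_zero.2 (Real.exp_ne_zero _)
  have hpos : 0 < ‖boundedMul (expNegTwoMulLp 𝕜 μ hℓ.measurable) f‖ :=
    norm_pos_iff.2 (boundedMul_ne_zero weight_ne_zero hf)
  obtain ⟨_, ⟨g, rfl⟩, hg⟩ := not_bddAbove_iff.1 hub
    (C / ‖boundedMul (expNegTwoMulLp 𝕜 μ hℓ.measurable) f‖)
  refine ⟨g, lt_of_lt_of_le ?_ (exp_mul_norm_le_norm_weightedTranslationRep hℓ g f)⟩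
  rw [← div_lt_iff₀ hpos]
  linarith [Real.add_one_le_exp (ℓ g)]

theorem inner_exp_neg_weightedTranslationRep (hℓ : Continuous ℓ)
    (hU : MemLp (fun x => (Real.exp (-ℓ x) : 𝕜)) 2 μ) (g : G) (f : Lp 𝕜 2 μ) :
    inner 𝕜 (hU.toLp _) (weightedTranslationRep 𝕜 𝕜 2 μ hℓ g f) = inner 𝕜 (hU.toLp _) f := by
  have eq_translate : (fun x => inner 𝕜 (hU.toLp _ x) (weightedTranslationRep 𝕜 𝕜 2 μ hℓ g f x))
      =ᵐ[μ] fun x => (Real.exp (-ℓ (g⁻¹ * x)) : 𝕜) * f (g⁻¹ * x) := by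
    filter_upwards [hU.coeFn_toLp, coeFn_weightedTranslationRep (𝕜 := 𝕜) hℓ g f] with x hx hrep
    have : lengthCocycle ℓ g x * Real.exp (-ℓ x) = Real.exp (-ℓ (g⁻¹ * x)) := by
      rw [lengthCocycle, ← Real.exp_add]
      ring_nf
    rw [hx, hrep, RCLike.inner_apply, RCLike.conj_ofReal, ← this, RCLike.ofReal_mul, smul_eq_mul]
    ring
  have eq_self : (fun x => inner 𝕜 (hU.toLp _ x) (f x))
      =ᵐ[μ] fun x => (Real.exp (-ℓ x) : 𝕜) * f x := by
    filter_upwards [hU.coeFn_toLp] with x hx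
    rw [hx, RCLike.inner_apply, RCLike.conj_ofReal, mul_comm]
  rw [L2.inner_def, L2.inner_def, integral_congr_ae eq_translate, integral_congr_ae eq_self]
  exact integral_mul_left_eq_self (fun x => (Real.exp (-ℓ x) : 𝕜) * f x) g⁻¹

end WeightedTranslation

section Hilbert

theorem isReflexiveSpace_of_innerProductSpace (𝕜 : Type*) [RCLike 𝕜] (E : Type*)
    [NormedAddCommGroup E] [InnerProductSpace 𝕜 E] [CompleteSpace E] : IsReflexiveSpace 𝕜 E := by
  intro Φ
  let f : StrongDual 𝕜 E := LinearMap.mkContinuous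
    { toFun := fun x => star (Φ (InnerProductSpace.toDual 𝕜 E x))
      map_add' := by simp
      map_smul' := by simp [map_smulₛₗ] } ‖Φ‖ fun x => by
        simpa using Φ.le_opNorm (InnerProductSpace.toDual 𝕜 E x)
  refine ⟨(InnerProductSpace.toDual 𝕜 E).symm f, ?_⟩
  ext φ
  obtain ⟨x, rfl⟩ := (InnerProductSpace.toDual 𝕜 E).surjective φ
  rw [NormedSpace.dual_def, InnerProductSpace.toDual_apply_apply, ← inner_conj_symm,
    InnerProductSpace.toDual_symm_apply]
  simp [f]

theorem IsReflexiveSpace.of_continuousLinearEquiv {𝕜 : Type*} [RCLike 𝕜] {E F : Type*}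
    [NormedAddCommGroup E] [NormedSpace 𝕜 E] [NormedAddCommGroup F] [NormedSpace 𝕜 F]
    (e : E ≃L[𝕜] F) (h : IsReflexiveSpace 𝕜 E) : IsReflexiveSpace 𝕜 F := by
  intro Φ
  let T : StrongDual 𝕜 E →L[𝕜] StrongDual 𝕜 F :=
    (ContinuousLinearMap.compL 𝕜 F E 𝕜).flip (e.symm : F →L[𝕜] E)
  obtain ⟨x, hx⟩ := h (Φ.comp T)
  refine ⟨e x, ?_⟩
  ext φ
  have h1 := congrArg (fun Ψ => Ψ (φ.comp (e : E →L[𝕜] F))) hx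
  have h2 : T (φ.comp (e : E →L[𝕜] F)) = φ := by ext y; simp [T]
  simpa [NormedSpace.dual_def, h2] using h1

theorem countable_of_orthonormal {𝕜 E ι : Type*} [RCLike 𝕜] [NormedAddCommGroup E]
    [InnerProductSpace 𝕜 E] [TopologicalSpace.SeparableSpace E] {v : ι → E}
    (hv : Orthonormal 𝕜 v) : Countable ι := by
  refine Pairwise.countable_of_isOpen_disjoint (s := fun i => Metric.ball (v i) 2⁻¹) ?_
    (fun _ => Metric.isOpen_ball) fun i => Metric.nonempty_ball.2 (by norm_num)
  intro i j hij
  refine Metric.ball_disjoint_ball ?_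
  have h1 : ‖v i - v j‖ * ‖v i - v j‖ = 2 := by
    rw [norm_sub_mul_self (𝕜 := 𝕜), hv.2 hij, hv.1, hv.1]
    norm_num
  rw [dist_eq_norm]
  nlinarith [norm_nonneg (v i - v j)]

theorem exists_hilbertBasis_nat {𝕜 E : Type*} [RCLike 𝕜]
    [NormedAddCommGroup E] [InnerProductSpace 𝕜 E] [CompleteSpace E]
    [TopologicalSpace.SeparableSpace E] (hE : ¬ FiniteDimensional 𝕜 E) :
    Nonempty (HilbertBasis ℕ 𝕜 E) := by
  obtain ⟨w, b, -⟩ := exists_hilbertBasis 𝕜 E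
  have : Countable w := countable_of_orthonormal b.orthonormal
  have : Infinite w := by
    by_contra h
    rw [not_infinite_iff_finite] at h
    have := Fintype.ofFinite w
    exact hE (Module.Finite.of_basis b.toOrthonormalBasis.toBasis)
  obtain ⟨e⟩ := nonempty_equiv_of_countable (α := ℕ) (β := w)
  refine ⟨HilbertBasis.mk (v := b ∘ e) (b.orthonormal.comp _ e.injective) ?_⟩
  rw [e.surjective.range_comp, b.dense_span]

theorem nonempty_linearIsometryEquiv_of_separable {𝕜 E F : Type*} [RCLike 𝕜]
    [NormedAddCommGroup E] [InnerProductSpace 𝕜 E] [CompleteSpace E]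
    [TopologicalSpace.SeparableSpace E] [NormedAddCommGroup F] [InnerProductSpace 𝕜 F]
    [CompleteSpace F] [TopologicalSpace.SeparableSpace F]
    (hE : ¬ FiniteDimensional 𝕜 E) (hF : ¬ FiniteDimensional 𝕜 F) :
    Nonempty (E ≃ₗᵢ[𝕜] F) := by
  obtain ⟨b⟩ := exists_hilbertBasis_nat hE
  obtain ⟨c⟩ := exists_hilbertBasis_nat hF
  exact ⟨b.repr.trans c.repr.symm⟩

theorem nonempty_prod_continuousLinearEquiv_right {𝕜 E F : Type*} [RCLike 𝕜]
    [NormedAddCommGroup E] [InnerProductSpace 𝕜 E] [CompleteSpace E]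
    [TopologicalSpace.SeparableSpace E] [NormedAddCommGroup F] [InnerProductSpace 𝕜 F]
    [CompleteSpace F] [TopologicalSpace.SeparableSpace F] (hF : ¬ FiniteDimensional 𝕜 F) :
    Nonempty ((E × F) ≃L[𝕜] F) := by
  have e := WithLp.prodContinuousLinearEquiv 2 𝕜 E F
  have : TopologicalSpace.SeparableSpace (WithLp 2 (E × F)) :=
    e.symm.surjective.denseRange.separableSpace e.symm.continuous
  have h : ¬ FiniteDimensional 𝕜 (WithLp 2 (E × F)) := fun h => hF <|
    Module.Finite.of_surjective ((ContinuousLinearMap.snd 𝕜 E F).toLinearMap ∘ₗ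
      e.toLinearEquiv.toLinearMap) (Prod.snd_surjective.comp e.surjective)
  obtain ⟨f⟩ := nonempty_linearIsometryEquiv_of_separable h hF
  exact ⟨e.symm.trans f.toContinuousLinearEquiv⟩

end Hilbert

section Representations

variable {𝕜 : Type*} [RCLike 𝕜] {G : Type*} [Group G] {X Y : Type*}
  [NormedAddCommGroup X] [NormedSpace 𝕜 X] [NormedAddCommGroup Y] [NormedSpace 𝕜 Y]

instance : IsOneApplyEqSelf (X ≃L[𝕜] X) X where
  one_apply_eq_self _ := rfl

instance : IsMulApplyEqComp (X ≃L[𝕜] X) X where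
  mul_apply_eq_comp _ _ _ := rfl

theorem IsContinuousLinearRep.comp [TopologicalSpace G] {π : G →* (X ≃L[𝕜] X)}
    (hπ : IsContinuousLinearRep π) {Z : Type*} [TopologicalSpace Z] {a : Z → G} {b : Z → X}
    (ha : Continuous a) (hb : Continuous b) : Continuous fun z => π (a z) (b z) :=
  Continuous.comp (g := fun p : G × X => π p.1 p.2) hπ (ha.prodMk hb)

theorem IsContinuousAffineRep.comp [TopologicalSpace G] {ρ : G →* (X ≃ᵃ[𝕜] X)}
    (hρ : IsContinuousAffineRep ρ) {Z : Type*} [TopologicalSpace Z] {a : Z → G} {b : Z → X}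
    (ha : Continuous a) (hb : Continuous b) : Continuous fun z => ρ (a z) (b z) :=
  Continuous.comp (g := fun p : G × X => ρ p.1 p.2) hρ (ha.prodMk hb)

/-- The conjugate of an affine representation by a linear homeomorphism. -/
def affineRepCongr (e : X ≃L[𝕜] Y) (ρ : G →* (X ≃ᵃ[𝕜] X)) : G →* (Y ≃ᵃ[𝕜] Y) where
  toFun g := (e.symm.toLinearEquiv.toAffineEquiv.trans (ρ g)).trans e.toLinearEquiv.toAffineEquiv
  map_one' := by ext; simp
  map_mul' g h := by ext; simp

@[simp]
theorem affineRepCongr_apply (e : X ≃L[𝕜] Y) (ρ : G →* (X ≃ᵃ[𝕜] X)) (g : G) (y : Y) :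
    affineRepCongr e ρ g y = e (ρ g (e.symm y)) := rfl

theorem IsContinuousAffineRep.congr [TopologicalSpace G] {ρ : G →* (X ≃ᵃ[𝕜] X)}
    (hρ : IsContinuousAffineRep ρ) (e : X ≃L[𝕜] Y) :
    IsContinuousAffineRep (affineRepCongr e ρ) := by
  have : Continuous fun p : G × Y => ρ p.1 (e.symm p.2) :=
    hρ.comp (by fun_prop) (by fun_prop)
  exact e.continuous.comp this

theorem isBounded_affineOrbit_of_congr {e : X ≃L[𝕜] Y} {ρ : G →* (X ≃ᵃ[𝕜] X)} {y : Y}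
    (h : Bornology.IsBounded (affineOrbit (affineRepCongr e ρ) y)) :
    Bornology.IsBounded (affineOrbit ρ (e.symm y)) := by
  refine (e.symm.lipschitz.isBounded_image h).subset ?_
  rintro _ ⟨g, rfl⟩
  exact ⟨_, ⟨g, rfl⟩, by simp⟩

/-- The conjugate of a linear representation by a linear homeomorphism. -/
def linearRepCongr (e : X ≃L[𝕜] Y) (π : G →* (X ≃L[𝕜] X)) : G →* (Y ≃L[𝕜] Y) where
  toFun g := (e.symm.trans (π g)).trans e
  map_one' := by ext; simp
  map_mul' g h := by ext; simp

theorem IsContinuousLinearRep.congr [TopologicalSpace G] {π : G →* (X ≃L[𝕜] X)}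
    (hπ : IsContinuousLinearRep π) (e : X ≃L[𝕜] Y) :
    IsContinuousLinearRep (linearRepCongr e π) := by
  have : Continuous fun p : G × Y => π p.1 (e.symm p.2) :=
    hπ.comp (by fun_prop) (by fun_prop)
  exact e.continuous.comp this

theorem IsBoundedLinearRep.exists_norm_apply_le {π : G →* (X ≃L[𝕜] X)}
    (hπ : IsBoundedLinearRep π) (x : X) : ∃ C : ℝ, ∀ g, ‖π g x‖ ≤ C := by
  obtain ⟨C, hC⟩ := hπ
  exact ⟨C * ‖x‖, fun g => (π g : X →L[𝕜] X).le_of_opNorm_le (hC g) x⟩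

theorem IsBoundedLinearRep.of_congr {e : X ≃L[𝕜] Y} {π : G →* (X ≃L[𝕜] X)}
    (h : IsBoundedLinearRep (linearRepCongr e π)) : IsBoundedLinearRep π := by
  obtain ⟨C, hC⟩ := h
  refine ⟨‖(e.symm : Y →L[𝕜] X)‖ * (C * ‖(e : X →L[𝕜] Y)‖), fun g => ?_⟩
  have conj : (π g : X →L[𝕜] X) =
      (e.symm : Y →L[𝕜] X) ∘L (linearRepCongr e π g : Y →L[𝕜] Y) ∘L (e : X →L[𝕜] Y) := by
    ext x
    simp [linearRepCongr]
  rw [conj]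
  refine (ContinuousLinearMap.opNorm_comp_le _ _).trans ?_
  gcongr
  refine (ContinuousLinearMap.opNorm_comp_le _ _).trans ?_
  gcongr
  exact hC g

/-- The product of a linear representation with the trivial one. -/
def linearRepProd (Y : Type*) [NormedAddCommGroup Y] [NormedSpace 𝕜 Y]
    (π : G →* (X ≃L[𝕜] X)) : G →* ((X × Y) ≃L[𝕜] (X × Y)) where
  toFun g := (π g).prodCongr (.refl 𝕜 Y)
  map_one' := by ext x <;> simp
  map_mul' g h := by ext <;> simp

theorem IsContinuousLinearRep.prod [TopologicalSpace G] {π : G →* (X ≃L[𝕜] X)}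
    (hπ : IsContinuousLinearRep π) :
    IsContinuousLinearRep (linearRepProd Y π) := by
  have : Continuous fun p : G × (X × Y) => π p.1 p.2.1 :=
    hπ.comp (by fun_prop) (by fun_prop)
  exact this.prodMk (continuous_snd.comp continuous_snd)

theorem IsBoundedLinearRep.of_prod {π : G →* (X ≃L[𝕜] X)}
    (h : IsBoundedLinearRep (linearRepProd Y π)) : IsBoundedLinearRep π := by
  obtain ⟨C, hC⟩ := h
  refine ⟨C, fun g => ContinuousLinearMap.opNorm_le_bound _ ((norm_nonneg _).trans (hC g)) ?_⟩
  intro x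
  have := (linearRepProd Y π g : X × Y →L[𝕜] X × Y).le_of_opNorm_le (hC g) (x, 0)
  simpa [linearRepProd] using this

/-- The product of an affine representation with the trivial one. -/
def affineRepProd (Y : Type*) [NormedAddCommGroup Y] [NormedSpace 𝕜 Y]
    (ρ : G →* (X ≃ᵃ[𝕜] X)) : G →* ((X × Y) ≃ᵃ[𝕜] (X × Y)) where
  toFun g := (ρ g).prodCongr (.refl 𝕜 Y)
  map_one' := by ext x <;> simp
  map_mul' g h := by ext <;> simp

theorem IsContinuousAffineRep.prod [TopologicalSpace G] {ρ : G →* (X ≃ᵃ[𝕜] X)}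
    (hρ : IsContinuousAffineRep ρ) :
    IsContinuousAffineRep (affineRepProd Y ρ) := by
  have : Continuous fun p : G × (X × Y) => ρ p.1 p.2.1 :=
    hρ.comp (by fun_prop) (by fun_prop)
  exact this.prodMk (continuous_snd.comp continuous_snd)

theorem isBounded_affineOrbit_of_prod {ρ : G →* (X ≃ᵃ[𝕜] X)} {p : X × Y}
    (h : Bornology.IsBounded (affineOrbit (affineRepProd Y ρ) p)) :
    Bornology.IsBounded (affineOrbit ρ p.1) := by
  refine h.image_fst.subset ?_
  rintro _ ⟨g, rfl⟩
  exact ⟨_, ⟨g, rfl⟩, rfl⟩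

/-- If a linear representation fixes the functional `φ`, it acts by affine maps on the hyperplane
`φ = φ v`, identified with `ker φ` by subtracting `v`. -/
def affineRepKer (π : G →* (X ≃L[𝕜] X)) (φ : StrongDual 𝕜 X) (hφ : ∀ g x, φ (π g x) = φ x)
    (v : X) : G →* (φ.ker ≃ᵃ[𝕜] φ.ker) :=
  AffineEquiv.equivUnitsAffineMap.symm.toMonoidHom.comp <| MonoidHom.toHomUnits
    { toFun := fun g =>
        { toFun := fun x => ⟨π g (x + v) - v, by simp [hφ]⟩
          linear := ((π g).toLinearEquiv.toLinearMap.domRestrict φ.ker).codRestrict φ.ker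
            fun x => by simp [hφ]
          map_vadd' := fun x y => by
            ext
            change π g (y + x + v) - v = π g y + (π g (x + v) - v)
            rw [add_assoc, map_add, add_sub_assoc] }
      map_one' := by ext; simp
      map_mul' := fun g h => by ext; simp }

theorem isContinuousAffineRep_affineRepKer [TopologicalSpace G] {π : G →* (X ≃L[𝕜] X)}
    (hπ : IsContinuousLinearRep π) (φ : StrongDual 𝕜 X) (hφ : ∀ g x, φ (π g x) = φ x) (v : X) :
    IsContinuousAffineRep (affineRepKer π φ hφ v) := by
  refine Continuous.subtype_mk (Continuous.sub ?_ continuous_const) _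
  exact hπ.comp (by fun_prop) (by fun_prop)

theorem not_isBounded_affineOrbit_affineRepKer {π : G →* (X ≃L[𝕜] X)} {φ : StrongDual 𝕜 X}
    (hφ : ∀ g x, φ (π g x) = φ x) (hub : ∀ x : X, x ≠ 0 → ∀ C : ℝ, ∃ g, C < ‖π g x‖) {v : X}
    (hv : φ v ≠ 0) (y : φ.ker) :
    ¬ Bornology.IsBounded (affineOrbit (affineRepKer π φ hφ v) y) := by
  intro hb
  obtain ⟨C, hC⟩ := hb.exists_norm_le
  have add_ne_zero : (y : X) + v ≠ 0 := fun h => hv <| by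
    rw [← map_zero φ, ← h, map_add, show φ y = 0 from y.2, zero_add]
  obtain ⟨g, hg⟩ := hub _ add_ne_zero (C + ‖v‖)
  have : ‖π g (y + v) - v‖ ≤ C := hC _ ⟨g, rfl⟩
  linarith [norm_le_norm_sub_add (π g (y + v)) v]

theorem isBounded_affineOrbit_of_fixedPoint {ρ : G →* (X ≃ᵃ[𝕜] X)} {x : X}
    (hx : ∀ g, ρ g x = x) : Bornology.IsBounded (affineOrbit ρ x) := by
  refine Bornology.isBounded_singleton.subset (t := {x}) ?_
  rintro _ ⟨g, rfl⟩
  exact hx g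

variable [TopologicalSpace G] [CompactSpace G]

theorem isBoundedLinearRep_of_compactSpace [CompleteSpace X] {π : G →* (X ≃L[𝕜] X)}
    (hπ : IsContinuousLinearRep π) : IsBoundedLinearRep π := by
  refine banach_steinhaus fun x => ?_
  have : Continuous fun g => π g x := hπ.comp (by fun_prop) (by fun_prop)
  obtain ⟨C, hC⟩ := isCompact_univ.exists_bound_of_continuousOn this.continuousOn
  exact ⟨C, fun g => hC g trivial⟩

theorem exists_fixedPoint_of_compactSpace [IsTopologicalGroup G] [CompleteSpace X]
    {ρ : G →* (X ≃ᵃ[𝕜] X)} (hρ : IsContinuousAffineRep ρ) : ∃ x, ∀ g, ρ g x = x := by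
  borelize G
  let _ : NormedSpace ℝ X := NormedSpace.restrictScalars ℝ 𝕜 X
  let μ : Measure G := Measure.haarMeasure ⊤
  have : IsProbabilityMeasure μ := ⟨Measure.haarMeasure_self⟩
  have orbit_integrable : Integrable (fun g => ρ g 0) μ :=
    (hρ.comp continuous_id continuous_const).integrable_of_hasCompactSupport
      (.of_compactSpace _)
  refine ⟨∫ g, ρ g 0 ∂μ, fun h => ?_⟩
  let T : X →L[𝕜] X := ⟨(ρ h).linear.toLinearMap,
    (AffineMap.continuous_linear_iff (f := (ρ h).toAffineMap)).2
      (hρ.comp continuous_const continuous_id)⟩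
  have hT : ∀ x, ρ h x = T x + ρ h 0 := congrFun (ρ h).toAffineMap.decomp
  calc ρ h (∫ g, ρ g 0 ∂μ) = T (∫ g, ρ g 0 ∂μ) + ρ h 0 := hT _
    _ = ∫ g, (T (ρ g 0) + ρ h 0) ∂μ := by
      rw [← T.integral_comp_comm orbit_integrable,
        integral_add (T.integrable_comp orbit_integrable) (integrable_const _)]
      simp
    _ = ∫ g, ρ (h * g) 0 ∂μ := by simp [← hT]
    _ = ∫ g, ρ g 0 ∂μ := integral_mul_left_eq_self (fun g => ρ g 0) h

end Representations

theorem PropertyACR.exists_fixedPoint {𝕜 : Type u₁} [RCLike 𝕜] {G : Type u₂} [Group G]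
    [TopologicalSpace G] (h : PropertyACR.{u₂, v₂, u₁} 𝕜 G) {H : Type*} [NormedAddCommGroup H]
    [InnerProductSpace 𝕜 H] [CompleteSpace H] [TopologicalSpace.SeparableSpace H]
    {ρ : G →* (H ≃ᵃ[𝕜] H)} (hρ : IsContinuousAffineRep ρ) : ∃ x, ∀ g, ρ g x = x := by
  have : Small.{v₂} H := small_of_separableSpace H
  let e₀ : Shrink.{v₂} H ≃ₗᵢ[𝕜] H := ⟨Shrink.linearEquiv 𝕜 H, fun _ => rfl⟩
  let e : H ≃L[𝕜] Shrink.{v₂} H := e₀.symm.toContinuousLinearEquiv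
  have : CompleteSpace (Shrink.{v₂} H) :=
    (completeSpace_congr (e := e.toEquiv) e.isUniformEmbedding).1 inferInstance
  have : TopologicalSpace.SeparableSpace (Shrink.{v₂} H) :=
    e.surjective.denseRange.separableSpace e.continuous
  obtain ⟨x, hx⟩ := h (Shrink.{v₂} H)
    ((isReflexiveSpace_of_innerProductSpace 𝕜 H).of_continuousLinearEquiv e) _ (hρ.congr e)
  refine ⟨e.symm x, fun g => e.injective ?_⟩
  simpa using hx g

section Noncompact

variable {𝕜 : Type*} [RCLike 𝕜] {G : Type*} [Group G] [TopologicalSpace G]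
  {H : Type*} [NormedAddCommGroup H] [InnerProductSpace 𝕜 H] [CompleteSpace H]
  [TopologicalSpace.SeparableSpace H]

section InvariantFunctional

variable {V : Type*} [NormedAddCommGroup V] [InnerProductSpace 𝕜 V] [CompleteSpace V]
  [SecondCountableTopology V] {π : G →* (V ≃L[𝕜] V)}

theorem IsContinuousLinearRep.exists_not_isBoundedLinearRep (hπ : IsContinuousLinearRep π)
    (hH : ¬ FiniteDimensional 𝕜 H) (hub : ¬ IsBoundedLinearRep π) :
    ∃ σ : G →* (H ≃L[𝕜] H), IsContinuousLinearRep σ ∧ ¬ IsBoundedLinearRep σ := by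
  obtain ⟨e⟩ := nonempty_prod_continuousLinearEquiv_right (E := V) hH
  exact ⟨linearRepCongr e (linearRepProd H π), hπ.prod.congr e, fun h => hub h.of_congr.of_prod⟩

theorem IsContinuousLinearRep.exists_affineRep_forall_not_isBounded
    (hπ : IsContinuousLinearRep π) (hH : ¬ FiniteDimensional 𝕜 H) {φ : StrongDual 𝕜 V}
    (hφ : ∀ g f, φ (π g f) = φ f) (hub : ∀ f : V, f ≠ 0 → ∀ C : ℝ, ∃ g, C < ‖π g f‖) {v : V}
    (hv : φ v ≠ 0) :
    ∃ ρ : G →* (H ≃ᵃ[𝕜] H), IsContinuousAffineRep ρ ∧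
      ∀ x : H, ¬ Bornology.IsBounded (affineOrbit ρ x) := by
  have : CompleteSpace φ.ker := φ.isClosed_ker.completeSpace_coe
  obtain ⟨e⟩ := nonempty_prod_continuousLinearEquiv_right (E := φ.ker) hH
  refine ⟨affineRepCongr e (affineRepProd H (affineRepKer π φ hφ v)),
    (isContinuousAffineRep_affineRepKer hπ φ hφ v).prod.congr e, fun x hb => ?_⟩
  exact not_isBounded_affineOrbit_affineRepKer hφ hub hv _
    (isBounded_affineOrbit_of_prod (isBounded_affineOrbit_of_congr hb))

end InvariantFunctional

variable (𝕜 G) in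
theorem exists_isContinuousLinearRep_L2_haar_forall_unbounded_orbit [IsTopologicalGroup G]
    [T2Space G] [LocallyCompactSpace G] [SigmaCompactSpace G] [NoncompactSpace G]
    [MeasurableSpace G] [BorelSpace G] :
    ∃ (π : G →* (Lp 𝕜 2 (Measure.haar : Measure G) ≃L[𝕜] Lp 𝕜 2 (Measure.haar : Measure G)))
      (U : Lp 𝕜 2 (Measure.haar : Measure G)), IsContinuousLinearRep π ∧
      (∀ f, f ≠ 0 → ∀ C : ℝ, ∃ g, C < ‖π g f‖) ∧ U ≠ 0 ∧
      ∀ g f, inner 𝕜 U (π g f) = inner 𝕜 U f := by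
  obtain ⟨ℓ, hℓ, hint⟩ :=
    exists_continuous_groupSeminorm_integrable_exp_neg (Measure.haar : Measure G)
  have hU : MemLp (fun x => (Real.exp (-ℓ x) : 𝕜)) 2 (Measure.haar : Measure G) :=
    memLp_two_ofReal_of_integrable hint (fun _ => Real.exp_nonneg _) fun x => by simp
  have : Fact ((2 : ℝ≥0∞) ≠ ∞) := ⟨by simp⟩
  refine ⟨weightedTranslationRep 𝕜 𝕜 2 Measure.haar hℓ, hU.toLp _,
    isContinuousLinearRep_weightedTranslationRep hℓ, fun f hf => ?_, fun h => ?_,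
    inner_exp_neg_weightedTranslationRep hℓ hU⟩
  · exact exists_lt_norm_weightedTranslationRep hℓ
      (not_bddAbove_range_of_integrable_exp_neg hint) hf
  · rw [Lp.eq_zero_iff_ae_eq_zero] at h
    obtain ⟨x, hx, hx0⟩ := (hU.coeFn_toLp.and h).exists
    exact RCLike.ofReal_ne_zero.2 (Real.exp_ne_zero (-ℓ x)) (hx.symm.trans hx0)

variable [IsTopologicalGroup G] [PolishSpace G] [LocallyCompactSpace G] [NoncompactSpace G]

variable (G) in
theorem exists_isContinuousLinearRep_not_isBoundedLinearRep (hH : ¬ FiniteDimensional 𝕜 H) :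
    ∃ π : G →* (H ≃L[𝕜] H), IsContinuousLinearRep π ∧ ¬ IsBoundedLinearRep π := by
  borelize G
  obtain ⟨π, U, hπ, hub, hU, -⟩ :=
    exists_isContinuousLinearRep_L2_haar_forall_unbounded_orbit 𝕜 G
  have : Fact ((2 : ℝ≥0∞) ≠ ∞) := ⟨by simp⟩
  have := Lp.SecondCountableTopology (μ := (Measure.haar : Measure G)) (p := 2) (E := 𝕜)
  refine hπ.exists_not_isBoundedLinearRep hH fun hb => ?_
  obtain ⟨C, hC⟩ := hb.exists_norm_apply_le U
  obtain ⟨g, hg⟩ := hub U hU C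
  exact hg.not_ge (hC g)

variable (G) in
theorem exists_isContinuousAffineRep_forall_not_isBounded (hH : ¬ FiniteDimensional 𝕜 H) :
    ∃ ρ : G →* (H ≃ᵃ[𝕜] H), IsContinuousAffineRep ρ ∧
      ∀ x : H, ¬ Bornology.IsBounded (affineOrbit ρ x) := by
  borelize G
  obtain ⟨π, U, hπ, hub, hU, hinv⟩ :=
    exists_isContinuousLinearRep_L2_haar_forall_unbounded_orbit 𝕜 G
  have : Fact ((2 : ℝ≥0∞) ≠ ∞) := ⟨by simp⟩
  have := Lp.SecondCountableTopology (μ := (Measure.haar : Measure G)) (p := 2) (E := 𝕜)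
  exact hπ.exists_affineRep_forall_not_isBounded hH (φ := innerSL 𝕜 U) hinv hub
    (inner_self_ne_zero.2 hU)

end Noncompact

theorem mainTheorem2 {𝕜 : Type u₁} [RCLike 𝕜]
    (G : Type u₂) [Group G] [TopologicalSpace G] [IsTopologicalGroup G] [PolishSpace G]
    [LocallyCompactSpace G]
    (H : Type u₃) [NormedAddCommGroup H] [InnerProductSpace 𝕜 H] [CompleteSpace H]
    [TopologicalSpace.SeparableSpace H] (hH : ¬ FiniteDimensional 𝕜 H) :
    List.TFAE [
      CompactSpace G,
      PropertyOB.{u₂, v₁} G,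
      PropertyACR.{u₂, v₂, u₁} 𝕜 G,
      ∀ π : G →* (H ≃L[𝕜] H), IsContinuousLinearRep π → IsBoundedLinearRep π,
      ∀ ρ : G →* (H ≃ᵃ[𝕜] H), IsContinuousAffineRep ρ → ∃ x : H, ∀ g : G, ρ g x = x,
      ∀ ρ : G →* (H ≃ᵃ[𝕜] H), IsContinuousAffineRep ρ →
        ∃ x : H, Bornology.IsBounded (affineOrbit ρ x)] ∧
    (¬ CompactSpace G →
      ∃ ρ : G →* (H ≃ᵃ[𝕜] H), IsContinuousAffineRep ρ ∧
        ∀ x : H, ¬ Bornology.IsBounded (affineOrbit ρ x)) := by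
  refine ⟨?_, fun hG => ?_⟩
  · tfae_have 1 → 2 := fun _ => .of_compactSpace G
    tfae_have 2 → 1 := PropertyOB.compactSpace
    tfae_have 1 → 3 := fun _ _ _ _ _ _ _ _ hρ => exists_fixedPoint_of_compactSpace hρ
    tfae_have 3 → 5 := fun hACR _ hρ => hACR.exists_fixedPoint hρ
    tfae_have 5 → 6 := fun hfix ρ hρ => (hfix ρ hρ).imp fun _ => isBounded_affineOrbit_of_fixedPoint
    tfae_have 6 → 1 := fun hbdd => by
      by_contra hG
      have := not_compactSpace_iff.1 hG
      obtain ⟨ρ, hρ, hub⟩ := exists_isContinuousAffineRep_forall_not_isBounded G hH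
      exact (hbdd ρ hρ).elim hub
    tfae_have 1 → 4 := fun _ _ hπ => isBoundedLinearRep_of_compactSpace hπ
    tfae_have 4 → 1 := fun hbdd => by
      by_contra hG
      have := not_compactSpace_iff.1 hG
      obtain ⟨π, hπ, hub⟩ := exists_isContinuousLinearRep_not_isBoundedLinearRep G hH
      exact hub (hbdd π hπ)
    tfae_finish
  · have := not_compactSpace_iff.1 hG
    exact exists_isContinuousAffineRep_forall_not_isBounded G hH
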